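/- Let $X$ be a real Banach space. Let $c(X)$ be the family of nonempty closed convex subsets of $X$, and $cb(X)$ the family of bounded members of $c(X)$. For $C\in c(X)$ and $x^*\in X^*$ put $s(x^*,C)=\sup_{x\in C}\langle x^*,x\rangle\in(-\infty,+\infty]$ and $\|C\|_h=\sup_{x\in C}\|x\|$; let $d_H$ be the Hausdorff distance. Let $\lambda$ be Lebesgue measure on $[0,1]$ and $\mathcal L$ the $\sigma$-algebra of Lebesgue measurable subsets of $[0,1]$. A map $\Gamma:[0,1]\to c(X)$ is called Pettis integrable in $cb(X)$ if for every $x^*\in X^*$ the function $t\mapsto s(x^*,\Gamma(t))$ is a.e. finite and Lebesgue integrable, and for every $A\in\mathcal L$ there is a set $M_\Gamma(A)\in cb(X)$ (necessarily unique) with $s(x^*,M_\Gamma(A))=\int_A s(x^*,\Gamma)\,d\lambda$ for all $x^*\in X^*$. The map $M_\Gamma:\mathcal L\to cb(X)$ is the indefinite Pettis integral of $\Gamma$. Its variation on $[0,1]$ is $|M_\Gamma|([0,1])=\sup_\pi\sum_{A\in\pi}\|M_\Gamma(A)\|_h$, where $\pi$ runs over the finite partitions of $[0,1]$ into pairwise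 disjoint members of $\mathcal L$. Finally, $\Gamma$ is called strongly Pettis integrable in $cb(X)$ if it is Pettis integrable in $cb(X)$ and $M_\Gamma$ is countably additive in the Hausdorff metric, i.e. $\lim_{n\to\infty} d_H\bigl(\overline{M_\Gamma(A_1)+\dots+M_\Gamma(A_n)},\,M_\Gamma(\bigcup_k A_k)\bigr)=0$ for every sequence $(A_k)$ of pairwise disjoint members of $\mathcal L$. **Corollary.** If $\Gamma:[0,1]\to c(X)$ is Pettis integrable in $cb(X)$ and $|M_\Gamma|([0,1])<\infty$, then $\Gamma$ is strongly Pettis integrable in $cb(X)$. -/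

import Mathlib

noncomputable section

namespace Multi

open MeasureTheory Filter Topology
open scoped ENNReal Pointwise unitInterval

section Families

variable (X : Type*) [NormedAddCommGroup X] [NormedSpace ℝ X]

/-- `c(X)`: the nonempty closed convex subsets of `X`. -/
def closedConvexSets : Set (Set X) :=
  {C | C.Nonempty ∧ IsClosed C ∧ Convex ℝ C}

/-- `cb(X)`: the bounded members of `c(X)`. -/
def boundedClosedConvexSets : Set (Set X) :=
  {C | C ∈ closedConvexSets X ∧ Bornology.IsBounded C}

end Families

/-- `‖C‖_h = sup {‖x‖ : x ∈ C}`, with values in `[0, ∞]`. -/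
def hNorm {X : Type*} [NormedAddCommGroup X] (C : Set X) : ℝ≥0∞ :=
  ⨆ x ∈ C, ‖x‖ₑ

/-- For nonempty `C`, `‖C‖_h` is the Hausdorff distance of `C` and `{0}`. -/
theorem hNorm_eq_hausdorffEDist {X : Type*} [NormedAddCommGroup X]
    {C : Set X} (hC : C.Nonempty) :
    hNorm C = Metric.hausdorffEDist C {0} := by
  rw [Metric.hausdorffEDist_def]
  simp only [Metric.infEDist_singleton, Set.mem_singleton_iff, iSup_iSup_eq_left,
    edist_zero_right]
  refine (sup_eq_left.2 ?_).symm
  obtain ⟨x, hx⟩ := hC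
  calc Metric.infEDist 0 C ≤ edist 0 x := Metric.infEDist_le_edist_of_mem hx
    _ = ‖x‖ₑ := edist_zero_left x
    _ ≤ ⨆ x ∈ C, ‖x‖ₑ := le_iSup₂ (f := fun x (_ : x ∈ C) => ‖x‖ₑ) x hx

section Integral

variable {X : Type*} [NormedAddCommGroup X] [NormedSpace ℝ X]

/-- The support function `s(x*, C) = sup {⟨x*, x⟩ : x ∈ C}`, with values in the extended reals
(it is `+∞` where `x*` is unbounded above on `C`). -/
def supportFun (f : StrongDual ℝ X) (C : Set X) : EReal :=
  ⨆ x ∈ C, ((f x : ℝ) : EReal)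

/-- Lebesgue measurable subsets of `[0,1]` (that is, up to a null set, Borel sets). -/
def LebesgueMeasurableSet (A : Set I) : Prop :=
  NullMeasurableSet A (volume : Measure I)

/-- `Γ` is scalarly integrable: for every `x*` the extended real function `s(x*, Γ(·))` is
Lebesgue integrable, i.e. almost everywhere finite with integrable real part. -/
def ScalarlyIntegrable (Γ : I → Set X) : Prop :=
  ∀ f : StrongDual ℝ X,
    (∀ᵐ t : I, supportFun f (Γ t) ≠ ⊤ ∧ supportFun f (Γ t) ≠ ⊥) ∧
    Integrable (fun t : I => (supportFun f (Γ t)).toReal)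

/-- `C` is a Pettis integral of `Γ` over `A`: `s(x*, C) = ∫_A s(x*, Γ) dλ` for every `x*`. -/
def IsPettisIntegralOn (Γ : I → Set X) (A : Set I) (C : Set X) : Prop :=
  ∀ f : StrongDual ℝ X,
    supportFun f C = ((∫ t in A, (supportFun f (Γ t)).toReal : ℝ) : EReal)

/-- `Γ` is Pettis integrable in the family `𝒞` of subsets of `X`. -/
def PettisIntegrable (Γ : I → Set X) (𝒞 : Set (Set X)) : Prop :=
  ScalarlyIntegrable Γ ∧
    ∀ A : Set I, LebesgueMeasurableSet A → ∃ C ∈ 𝒞, IsPettisIntegralOn Γ A C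

/-- The set function `M` (only its values on Lebesgue measurable sets matter) is the indefinite
Pettis integral of `Γ` in the family `𝒞`. -/
def IsIndefinitePettisIntegral (Γ : I → Set X) (𝒞 : Set (Set X)) (M : Set I → Set X) : Prop :=
  ∀ A : Set I, LebesgueMeasurableSet A → M A ∈ 𝒞 ∧ IsPettisIntegralOn Γ A (M A)

/-- `M` is countably additive in the Hausdorff metric on the Lebesgue measurable sets: for
pairwise disjoint `A 0, A 1, …`, the closures of the Minkowski sums
`M (A 0) + ⋯ + M (A (n - 1))` converge to `M (⋃ k, A k)`. -/
def IsHMultimeasure (M : Set I → Set X) : Prop :=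
  ∀ A : ℕ → Set I, (∀ k, LebesgueMeasurableSet (A k)) →
    Pairwise (fun j k => Disjoint (A j) (A k)) →
    Tendsto
      (fun n : ℕ => Metric.hausdorffEDist
        (closure (∑ k ∈ Finset.range n, M (A k))) (M (⋃ k, A k)))
      atTop (𝓝 0)

/-- `Γ` is strongly Pettis integrable in `𝒞`: it is Pettis integrable in `𝒞` and its indefinite
Pettis integral is countably additive in the Hausdorff metric. -/
def StronglyPettisIntegrable (Γ : I → Set X) (𝒞 : Set (Set X)) : Prop :=
  PettisIntegrable Γ 𝒞 ∧
    ∀ M : Set I → Set X, IsIndefinitePettisIntegral Γ 𝒞 M → IsHMultimeasure M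

/-- The variation `|M|(E)`: the supremum of `∑_{A ∈ π} ‖M(A)‖_h` over all finite partitions `π`
of `E` into pairwise disjoint Lebesgue measurable sets. -/
def variation (M : Set I → Set X) (E : Set I) : ℝ≥0∞ :=
  ⨆ π ∈ {π : Finset (Set I) | (∀ A ∈ π, LebesgueMeasurableSet A) ∧
      (π : Set (Set I)).PairwiseDisjoint id ∧ ⋃₀ (π : Set (Set I)) = E},
    ∑ A ∈ π, hNorm (M A)

end Integral

end Multi

end

namespace Multi

open MeasureTheory Filter Topology
open scoped ENNReal Pointwise unitInterval

/-! Support functions turn Minkowski sums into sums of integrals, and by Hahn–Banach they determine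
closed convex sets. Hence `M (⋃ k, A k)` is the closure of the `n`-th partial sum plus `M` of the
tail union (`iUnion_eq_closure_sum_add`), and the Hausdorff distance to be estimated is at most the
`hNorm` of that last term. Norming functionals give `hNorm_iUnion_le`, which bounds it by `∑ hNorm
(M (A k))` over `k ≥ n`. This is the tail of a series whose sum is at most the variation, so it
tends to `0`. -/

theorem hausdorffEDist_add_le_hNorm {X : Type*} [NormedAddCommGroup X] {S T : Set X} (hT : T.Nonempty) :
    Metric.hausdorffEDist S (S + T) ≤ hNorm T := by
  have hle : ∀ t ∈ T, ‖t‖ₑ ≤ hNorm T := fun t ht =>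
    le_iSup₂ (f := fun x (_ : x ∈ T) => ‖x‖ₑ) t ht
  obtain ⟨t₀, ht₀⟩ := hT
  refine Metric.hausdorffEDist_le_of_mem_edist (fun x hx => ?_) ?_
  · refine ⟨x + t₀, Set.add_mem_add hx ht₀, ?_⟩
    simpa [edist_eq_enorm_sub] using hle t₀ ht₀
  · rintro _ ⟨x, hx, t, ht, rfl⟩
    refine ⟨x, hx, ?_⟩
    simpa [edist_eq_enorm_sub] using hle t ht

theorem IsHMultimeasure.congr {X : Type*} [NormedAddCommGroup X]
    {M M' : Set I → Set X} (hM : IsHMultimeasure M)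
    (h : ∀ A, LebesgueMeasurableSet A → M A = M' A) : IsHMultimeasure M' := by
  intro A hA hd
  have := hM A hA hd
  simpa only [h _ (hA _), h _ (NullMeasurableSet.iUnion hA)] using this

section SupportFunctions

variable {X : Type*} [NormedAddCommGroup X] [NormedSpace ℝ X]

theorem isLUB_image_of_supportFun_eq {f : StrongDual ℝ X} {C : Set X} {a : ℝ}
    (h : supportFun f C = (a : EReal)) : IsLUB (f '' C) a := by
  refine ⟨?_, fun b hb => ?_⟩
  · rintro _ ⟨x, hx, rfl⟩
    rw [← EReal.coe_le_coe_iff, ← h]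
    exact le_iSup₂ (f := fun x (_ : x ∈ C) => ((f x : ℝ) : EReal)) x hx
  · rw [← EReal.coe_le_coe_iff, ← h]
    exact iSup₂_le fun x hx => EReal.coe_le_coe_iff.2 (hb ⟨x, hx, rfl⟩)

theorem isLUB_image_closure {f : StrongDual ℝ X} {C : Set X} {a : ℝ}
    (h : IsLUB (f '' C) a) : IsLUB (f '' closure C) a := by
  refine ⟨?_, fun b hb => h.2 (upperBounds_mono_set (Set.image_mono subset_closure) hb)⟩
  rintro _ ⟨x, hx, rfl⟩
  have hcl : IsClosed {x | f x ≤ a} := isClosed_le f.continuous continuous_const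
  exact closure_minimal (fun y hy => h.1 ⟨y, hy, rfl⟩) hcl hx

theorem isLUB_image_add {f : StrongDual ℝ X} {C D : Set X} {a b : ℝ}
    (hC : IsLUB (f '' C) a) (hD : IsLUB (f '' D) b) : IsLUB (f '' (C + D)) (a + b) := by
  rw [Set.image_add]
  exact hC.add hD

/-- A closed convex set contains every set whose support function is dominated by its own. -/
theorem subset_of_isLUB_image {C D : Set X} (hDc : IsClosed D) (hD : Convex ℝ D)
    (h : ∀ f : StrongDual ℝ X, ∃ a, IsLUB (f '' C) a ∧ IsLUB (f '' D) a) : C ⊆ D := by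
  intro x hx
  by_contra hxD
  obtain ⟨f, u, hu, hfx⟩ := geometric_hahn_banach_closed_point hD hDc hxD
  obtain ⟨a, ha, hb⟩ := h f
  have h1 : a ≤ u := hb.2 (by rintro _ ⟨y, hy, rfl⟩; exact (hu y hy).le)
  have h2 : f x ≤ a := ha.1 ⟨x, hx, rfl⟩
  linarith

/-- Closed convex sets with the same (finite) support function coincide. -/
theorem eq_of_isLUB_image {C D : Set X} (hCc : IsClosed C) (hC : Convex ℝ C)
    (hDc : IsClosed D) (hD : Convex ℝ D)
    (h : ∀ f : StrongDual ℝ X, ∃ a, IsLUB (f '' C) a ∧ IsLUB (f '' D) a) : C = D :=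
  (subset_of_isLUB_image hDc hD h).antisymm
    (subset_of_isLUB_image hCc hC fun f => (h f).imp fun _ => And.symm)

theorem enorm_le_hNorm_of_isLUB_image {f : StrongDual ℝ X} (hf : ‖f‖ ≤ 1) {C : Set X}
    (hC : C.Nonempty) {a : ℝ} (h : IsLUB (f '' C) a) : ‖a‖ₑ ≤ hNorm C := by
  by_cases htop : hNorm C = ⊤
  · simp [htop]
  have hle : ∀ x ∈ C, |f x| ≤ (hNorm C).toReal := fun x hx => by
    have h1 : ‖x‖ₑ ≤ hNorm C := le_iSup₂ (f := fun x (_ : x ∈ C) => ‖x‖ₑ) x hx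
    have h2 : ‖x‖ ≤ (hNorm C).toReal := by
      simpa using ENNReal.toReal_mono htop h1
    have h3 := f.le_of_opNorm_le hf x
    rw [one_mul, Real.norm_eq_abs] at h3
    exact h3.trans h2
  obtain ⟨x, hx⟩ := hC
  have h1 : a ≤ (hNorm C).toReal := h.2 (by
    rintro _ ⟨y, hy, rfl⟩; exact (le_abs_self _).trans (hle y hy))
  have h2 : f x ≤ a := h.1 ⟨x, hx, rfl⟩
  -- The supremum is bounded below through one point of `C`, which is where nonemptiness enters.
  have h3 : |a| ≤ (hNorm C).toReal := abs_le.2 ⟨by linarith [(abs_le.1 (hle x hx)).1], h1⟩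
  rw [Real.enorm_eq_ofReal_abs]
  exact ENNReal.ofReal_le_of_le_toReal h3

/-- Each `x ∈ C` is normed by some `f` in the dual unit ball, and then `‖x‖ = f x ≤ a`. -/
theorem hNorm_le_of_isLUB_image {C : Set X} {N : ℝ≥0∞}
    (h : ∀ f : StrongDual ℝ X, ‖f‖ ≤ 1 → ∃ a, IsLUB (f '' C) a ∧ ‖a‖ₑ ≤ N) : hNorm C ≤ N := by
  refine iSup₂_le fun x hx => ?_
  obtain ⟨f, hf, hfx⟩ := exists_dual_vector'' ℝ x
  obtain ⟨a, ha, haN⟩ := h f hf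
  have hxa : ‖x‖ ≤ a := by
    have := ha.1 ⟨x, hx, rfl⟩
    rwa [hfx] at this
  refine le_trans ?_ haN
  rw [← ofReal_norm, Real.enorm_eq_ofReal_abs]
  exact ENNReal.ofReal_le_ofReal (hxa.trans (le_abs_self a))

end SupportFunctions

section IndefiniteIntegral

variable {X : Type*} [NormedAddCommGroup X] [NormedSpace ℝ X]
  {Γ : I → Set X} {M : Set I → Set X}

namespace IsIndefinitePettisIntegral

theorem isLUB_image
    (hM : IsIndefinitePettisIntegral Γ (boundedClosedConvexSets X) M)
    {A : Set I} (hA : LebesgueMeasurableSet A) (f : StrongDual ℝ X) :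
    IsLUB (f '' M A) (∫ t in A, (supportFun f (Γ t)).toReal) :=
  isLUB_image_of_supportFun_eq ((hM A hA).2 f)

theorem eq_of_lebesgueMeasurableSet {M' : Set I → Set X}
    (hM : IsIndefinitePettisIntegral Γ (boundedClosedConvexSets X) M)
    (hM' : IsIndefinitePettisIntegral Γ (boundedClosedConvexSets X) M')
    {A : Set I} (hA : LebesgueMeasurableSet A) : M A = M' A :=
  eq_of_isLUB_image (hM A hA).1.1.2.1 (hM A hA).1.1.2.2 (hM' A hA).1.1.2.1 (hM' A hA).1.1.2.2
    fun f => ⟨_, hM.isLUB_image hA f, hM'.isLUB_image hA f⟩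

theorem hNorm_empty
    (hM : IsIndefinitePettisIntegral Γ (boundedClosedConvexSets X) M) : hNorm (M ∅) = 0 :=
  le_antisymm (hNorm_le_of_isLUB_image fun f _ =>
    ⟨_, hM.isLUB_image nullMeasurableSet_empty f, by simp⟩) zero_le

theorem sum_hNorm_le_variation
    (hM : IsIndefinitePettisIntegral Γ (boundedClosedConvexSets X) M)
    {A : ℕ → Set I} (hA : ∀ k, LebesgueMeasurableSet (A k))
    (hd : Pairwise fun j k => Disjoint (A j) (A k)) (n : ℕ) :
    ∑ k ∈ Finset.range n, hNorm (M (A k)) ≤ variation M Set.univ := by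
  classical
  set U : Set I := ⋃ k ∈ Finset.range n, A k with hU
  have hUm : NullMeasurableSet U (volume : Measure I) :=
    Finset.nullMeasurableSet_biUnion _ fun k _ => hA k
  -- The variation only admits partitions of the whole interval, so the complement of the union is
  -- added.
  set π : Finset (Set I) := insert Uᶜ ((Finset.range n).image A) with hπ
  have hdisj : ∀ k ∈ Finset.range n, Disjoint Uᶜ (A k) := fun k hk =>
    disjoint_compl_left.mono_right (Set.subset_biUnion_of_mem (u := A) hk)
  have hmem : π ∈ {π : Finset (Set I) | (∀ A ∈ π, LebesgueMeasurableSet A) ∧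
      (π : Set (Set I)).PairwiseDisjoint id ∧ ⋃₀ (π : Set (Set I)) = Set.univ} := by
    refine ⟨?_, ?_, ?_⟩
    · intro B hB
      rcases Finset.mem_insert.1 hB with rfl | hB
      · exact hUm.compl
      · obtain ⟨k, -, rfl⟩ := Finset.mem_image.1 hB
        exact hA k
    · rw [hπ, Finset.coe_insert]
      refine Set.PairwiseDisjoint.insert ?_ ?_
      · intro B hB C hC hBC
        obtain ⟨j, -, rfl⟩ := Finset.mem_image.1 (Finset.mem_coe.1 hB)
        obtain ⟨k, -, rfl⟩ := Finset.mem_image.1 (Finset.mem_coe.1 hC)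
        exact hd fun hjk => hBC (by rw [hjk])
      · intro B hB _
        obtain ⟨k, hk, rfl⟩ := Finset.mem_image.1 (Finset.mem_coe.1 hB)
        exact hdisj k hk
    · rw [hπ, Finset.coe_insert, Set.sUnion_insert, Finset.coe_image, Set.sUnion_image]
      exact Set.compl_union_self U
  -- The image merges equal sets `A j = A k`. Being disjoint, these are empty and contribute `hNorm
  -- (M ∅) = 0`.
  calc ∑ k ∈ Finset.range n, hNorm (M (A k))
      = ∑ B ∈ (Finset.range n).image A, hNorm (M B) :=
        (Finset.sum_image_of_disjoint (f := A) (g := fun B => hNorm (M B)) hM.hNorm_empty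
          fun j _ k _ hjk => hd hjk).symm
    _ ≤ ∑ B ∈ π, hNorm (M B) := Finset.sum_le_sum_of_subset (Finset.subset_insert _ _)
    _ ≤ variation M Set.univ :=
        le_iSup₂ (f := fun π (_ : π ∈ {π : Finset (Set I) |
          (∀ A ∈ π, LebesgueMeasurableSet A) ∧ (π : Set (Set I)).PairwiseDisjoint id ∧
            ⋃₀ (π : Set (Set I)) = Set.univ}) => ∑ B ∈ π, hNorm (M B)) π hmem

theorem tsum_hNorm_le_variation
    (hM : IsIndefinitePettisIntegral Γ (boundedClosedConvexSets X) M)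
    {A : ℕ → Set I} (hA : ∀ k, LebesgueMeasurableSet (A k))
    (hd : Pairwise fun j k => Disjoint (A j) (A k)) :
    ∑' k, hNorm (M (A k)) ≤ variation M Set.univ :=
  ENNReal.tsum_le_of_sum_range_le fun n => hM.sum_hNorm_le_variation hA hd n

theorem hNorm_iUnion_le
    (hM : IsIndefinitePettisIntegral Γ (boundedClosedConvexSets X) M)
    (hΓ : ScalarlyIntegrable Γ) {A : ℕ → Set I} (hA : ∀ k, LebesgueMeasurableSet (A k))
    (hd : Pairwise fun j k => Disjoint (A j) (A k)) :
    hNorm (M (⋃ k, A k)) ≤ ∑' k, hNorm (M (A k)) := by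
  refine hNorm_le_of_isLUB_image fun f hf =>
    ⟨_, hM.isLUB_image (NullMeasurableSet.iUnion hA) f, ?_⟩
  rw [integral_iUnion_ae hA (fun j k hjk => (hd hjk).aedisjoint) (hΓ f).2.integrableOn]
  exact enorm_tsum_le_tsum_enorm.trans (ENNReal.tsum_le_tsum fun k =>
    enorm_le_hNorm_of_isLUB_image hf (hM _ (hA k)).1.1.1 (hM.isLUB_image (hA k) f))

theorem convex_sum
    (hM : IsIndefinitePettisIntegral Γ (boundedClosedConvexSets X) M)
    {A : ℕ → Set I} (hA : ∀ k, LebesgueMeasurableSet (A k)) (n : ℕ) :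
    Convex ℝ (∑ k ∈ Finset.range n, M (A k)) := by
  induction n with
  | zero =>
    simp only [Finset.range_zero, Finset.sum_empty]
    exact convex_singleton (𝕜 := ℝ) (0 : X)
  | succ n ih =>
    rw [Finset.sum_range_succ]
    exact ih.add (hM _ (hA n)).1.1.2.2

theorem isLUB_image_sum
    (hM : IsIndefinitePettisIntegral Γ (boundedClosedConvexSets X) M)
    {A : ℕ → Set I} (hA : ∀ k, LebesgueMeasurableSet (A k)) (f : StrongDual ℝ X) (n : ℕ) :
    IsLUB (f '' ∑ k ∈ Finset.range n, M (A k))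
      (∑ k ∈ Finset.range n, ∫ t in A k, (supportFun f (Γ t)).toReal) := by
  induction n with
  | zero => simp
  | succ n ih =>
    rw [Finset.sum_range_succ, Finset.sum_range_succ]
    exact isLUB_image_add ih (hM.isLUB_image (hA n) f)

theorem iUnion_eq_closure_sum_add
    (hM : IsIndefinitePettisIntegral Γ (boundedClosedConvexSets X) M)
    (hΓ : ScalarlyIntegrable Γ) {A : ℕ → Set I} (hA : ∀ k, LebesgueMeasurableSet (A k))
    (hd : Pairwise fun j k => Disjoint (A j) (A k)) (n : ℕ) :
    M (⋃ k, A k) = closure (∑ k ∈ Finset.range n, M (A k) + M (⋃ k, A (k + n))) := by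
  have hU : LebesgueMeasurableSet (⋃ k, A k) := NullMeasurableSet.iUnion hA
  have hR : LebesgueMeasurableSet (⋃ k, A (k + n)) :=
    NullMeasurableSet.iUnion fun k => hA (k + n)
  refine eq_of_isLUB_image (hM _ hU).1.1.2.1 (hM _ hU).1.1.2.2 isClosed_closure
    ((hM.convex_sum hA n).add (hM _ hR).1.1.2.2).closure
    fun f => ⟨_, hM.isLUB_image hU f, ?_⟩
  have hd' : Pairwise fun j k => Disjoint (A (j + n)) (A (k + n)) :=
    fun j k hjk => hd fun h => hjk (Nat.add_right_cancel h)
  have hsum := hasSum_integral_iUnion_ae hA (fun j k hjk => (hd hjk).aedisjoint)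
    (hΓ f).2.integrableOn
  have htail := integral_iUnion_ae (fun k => hA (k + n))
    (fun j k hjk => (hd' hjk).aedisjoint) (hΓ f).2.integrableOn
  -- The integral over the union becomes the first `n` integrals plus the integral over the tail
  -- union.
  rw [← hsum.tsum_eq, ← hsum.summable.sum_add_tsum_nat_add n, ← htail]
  exact isLUB_image_closure
    (isLUB_image_add (hM.isLUB_image_sum hA f n) (hM.isLUB_image hR f))

/-- An indefinite Pettis integral of finite variation is countably additive in the Hausdorff
metric. -/
theorem isHMultimeasure
    (hM : IsIndefinitePettisIntegral Γ (boundedClosedConvexSets X) M)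
    (hΓ : ScalarlyIntegrable Γ) (hvar : variation M Set.univ < ⊤) : IsHMultimeasure M := by
  intro A hA hd
  have hfin : ∑' k, hNorm (M (A k)) ≠ ⊤ :=
    ((hM.tsum_hNorm_le_variation hA hd).trans_lt hvar).ne
  refine tendsto_of_tendsto_of_tendsto_of_le_of_le tendsto_const_nhds
    (ENNReal.tendsto_sum_nat_add (fun k => hNorm (M (A k))) hfin) (fun _ => zero_le) fun n => ?_
  have hd' : Pairwise fun j k => Disjoint (A (j + n)) (A (k + n)) :=
    fun j k hjk => hd fun h => hjk (Nat.add_right_cancel h)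
  have hR : LebesgueMeasurableSet (⋃ k, A (k + n)) :=
    NullMeasurableSet.iUnion fun k => hA (k + n)
  dsimp only
  -- Both sets are now closures, and the Hausdorff distance ignores closures.
  rw [hM.iUnion_eq_closure_sum_add hΓ hA hd n, Metric.hausdorffEDist_closure]
  exact (hausdorffEDist_add_le_hNorm (hM _ hR).1.1.1).trans
    (hM.hNorm_iUnion_le hΓ (fun k => hA (k + n)) hd')

end IsIndefinitePettisIntegral

end IndefiniteIntegral

end Multi

theorem mainTheorem5 {X : Type*} [NormedAddCommGroup X] [NormedSpace ℝ X] [CompleteSpace X]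
    (Γ : unitInterval → Set X) (hΓ : ∀ t, Γ t ∈ Multi.closedConvexSets X)
    (hP : Multi.PettisIntegrable Γ (Multi.boundedClosedConvexSets X))
    (M : Set unitInterval → Set X)
    (hM : Multi.IsIndefinitePettisIntegral Γ (Multi.boundedClosedConvexSets X) M)
    (hvar : Multi.variation M Set.univ < ⊤) :
    Multi.StronglyPettisIntegrable Γ (Multi.boundedClosedConvexSets X) :=
  -- Any other indefinite integral agrees with `M` on measurable sets, so additivity transfers to
  -- it.
  ⟨hP, fun _ hM' => (hM.isHMultimeasure hP.1 hvar).congr fun _ hA =>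
    hM.eq_of_lebesgueMeasurableSet hM' hA⟩
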